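/- Let $k\ge 2$ and let $c=c_0\cdots c_{k-1}$ be a word of non-negative integers with $c_0\ge 1$ and $c_{k-1}\ge 1$. Let $\mu_c$ be the morphism on $\{0,\dots,k-1\}^*$ with $\mu_c(i)=0^{c_i}\cdot(i+1)$ for $0\le i\le k-2$ and $\mu_c(k-1)=0^{c_{k-1}}$. Put $u_n=\mu_c^n(0)$ and $U_n=|u_n|$, and let $\mathbf u=\lim_{n\to\infty}u_n$ be the infinite fixed point of $\mu_c$ starting with $0$. A word $v$ is a fractional power of a non-empty word $z$ if $v=z^\ell x$ with $\ell\ge 0$ and $x$ a prefix of $z$. Let $Q_n$ be the length of the longest prefix of $\mathbf u$ that is a fractional power of $u_n$ (such a longest prefix exists), and let $$P_n=\begin{cases}U_n & \text{if } 0\le n\le k-1,\\ U_n+U_{n-k+1}-U_{n-k}-1 & \text{if } n\ge k.\end{cases}$$ Words over $\mathbb N$ are ordered lexicographically. A non-empty word is anti-Lyndon if it is primitive and lexicographically maximal among its conjugates (its cyclic permutations). Let $w$ be the longest anti-Lyndon prefix of $c_0\cdots c_{k-2}$. Let $\mathcal S_c$ be the numeration system in which $0$ is represented by the empty word and $n\ge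 1$ by the word $\ell_0\cdots\ell_N$ with $\ell_0\ge 1$ such that $\mathbf u[0,n)=u_N^{\ell_0}u_{N-1}^{\ell_1}\cdots u_0^{\ell_N}$, $u_{N+1}$ is not a prefix of $\mathbf u[0,n)$ and, for all $0\le i\le N$, $u_N^{\ell_0}\cdots u_{N-i+1}^{\ell_{i-1}}u_{N-i}^{\ell_i+1}$ is not a prefix of $\mathbf u[0,n)$. It is called greedy if these representations are the greedy representations based on the sequence $(U_n)_{n\ge 0}$. Assume that at least one of the following assertions holds: 1. for all $n\ge 0$, $\mathbf u[0,U_{n+1}-1)$ is a fractional power of $u_n$; 2. for all $n\ge 0$, the length-$(n+1)$ prefix of $\big(c_0\cdots c_{k-2}(c_{k-1}-1)\big)^\omega$ is lexicographically smaller than or equal to that of $w^\omega$; 3. the word $c_0\cdots c_{k-2}(c_{k-1}-1)$ is lexicographically maximal among its conjugates; 4. the numeration system $\mathcal S_c$ is greedy. Then the inequality $P_n-1\le Q_{n-1}$ holds for all $n\ge 1$ if and only if $c_{k-1}=1$ and $c_0\cdots c_{k-2}=w^\ell$ for some integer $\ell$. Moreover, in that case the intervals $[P_n,Q_n]$, $n\ge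 0$, cover all positive integers. -/

import Mathlib

namespace GenBonacci

/-! ### Words -/

/-- The power `x ^ n` of a finite word. -/
def wpow {A : Type*} (x : List A) (n : ℕ) : List A := (List.replicate n x).flatten

/-- `v` is a fractional power of `w`: `v = w ^ l x` with `x` a prefix of `w`. -/
def IsFracPow {A : Type*} (v w : List A) : Prop :=
  ∃ (l : ℕ) (x : List A), x <+: w ∧ v = wpow w l ++ x

/-- The length-`n` prefix `a[0, n)` of an infinite word `a`. -/
def pre {A : Type*} (a : ℕ → A) (n : ℕ) : List A := (List.range n).map a

/-- The infinite concatenation `w w w ⋯` of a non-empty word over `ℕ`. -/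
def omega (w : List ℕ) : ℕ → ℕ := fun n => w.getD (n % w.length) 0

/-- A non-empty word that is not a proper power. -/
def IsPrimitive {A : Type*} (w : List A) : Prop :=
  w ≠ [] ∧ ∀ (x : List A) (n : ℕ), x ≠ [] → w = wpow x n → n = 1

/-- Lexicographically maximal among the conjugates (the cyclic permutations). -/
def IsMaxConj (w : List ℕ) : Prop := ∀ x : List ℕ, x ~r w → x ≤ w

/-- Anti-Lyndon words: primitive and lexicographically maximal among the conjugates. -/
def IsAntiLyndon (w : List ℕ) : Prop := IsPrimitive w ∧ IsMaxConj w

/-- `w` is the longest anti-Lyndon prefix of `v`. -/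
def IsLongestAntiLyndonPrefix (w v : List ℕ) : Prop :=
  w <+: v ∧ IsAntiLyndon w ∧ ∀ x : List ℕ, x <+: v → IsAntiLyndon x → x.length ≤ w.length

/-! ### The morphism and its fixed point

The parameters are a word `c = c_0 ⋯ c_{k-1}`, with `k = c.length`. -/

/-- The letter `c_i` of `c` (used only for `i < c.length`). -/
def letter (c : List ℕ) (i : ℕ) : ℕ := c.getD i 0

/-- The last letter `c_{k-1}` of `c`. -/
def lastLetter (c : List ℕ) : ℕ := letter c (c.length - 1)

/-- The working hypothesis: `k ≥ 2`, `c_0 ≥ 1` and `c_{k-1} ≥ 1`. -/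
def WH (c : List ℕ) : Prop := 2 ≤ c.length ∧ 1 ≤ letter c 0 ∧ 1 ≤ lastLetter c

/-- The image of a letter `i < k` under `μ_c`: it is `0 ^ {c_i} (i + 1)` for `i ≤ k - 2`, and
`0 ^ {c_{k-1}}` for `i = k - 1`. -/
def muLetter (c : List ℕ) (i : ℕ) : List ℕ :=
  if i + 1 < c.length then List.replicate (letter c i) 0 ++ [i + 1]
  else List.replicate (letter c i) 0

/-- The morphism `μ_c`. -/
def mu (c : List ℕ) (x : List ℕ) : List ℕ := x.flatMap (muLetter c)

/-- The words `u_n = μ_c ^ n (0)`. -/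
def word (c : List ℕ) (n : ℕ) : List ℕ := (mu c)^[n] [0]

/-- The lengths `U_n = |u_n|`. -/
def U (c : List ℕ) (n : ℕ) : ℕ := (word c n).length

/-- The infinite fixed point `u = lim u_n`; under `WH c` the word `u_m` has length more than `m` and
is a prefix of all later ones, see `word_eq_pre`. -/
def u (c : List ℕ) : ℕ → ℕ := fun m => (word c m).getD m 0

theorem mu_iter_append (c : List ℕ) (n : ℕ) (x y : List ℕ) :
    (mu c)^[n] (x ++ y) = (mu c)^[n] x ++ (mu c)^[n] y := by
  induction n generalizing x y with
  | zero => rfl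
  | succ n ih =>
    rw [Function.iterate_succ_apply, Function.iterate_succ_apply, Function.iterate_succ_apply]
    rw [← ih, mu, List.flatMap_append]
    rfl

theorem mu_iter_ne_nil (c : List ℕ) (hc : WH c) (n : ℕ) (x : List ℕ) (hx : x ≠ [])
    (hlt : ∀ i ∈ x, i < c.length) : (mu c)^[n] x ≠ [] := by
  induction n generalizing x with
  | zero => exact hx
  | succ n ih =>
    rw [Function.iterate_succ_apply]
    obtain ⟨h2, -, h1⟩ := hc
    apply ih
    · obtain ⟨i, s, rfl⟩ := List.exists_cons_of_ne_nil hx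
      have hi : i < c.length := hlt i (by simp)
      intro h
      have h' : muLetter c i = [] := by
        simp only [mu, List.flatMap_cons, List.append_eq_nil_iff] at h
        exact h.1
      unfold muLetter at h'
      split_ifs at h' with hi'
      · simp at h'
      · have : i = c.length - 1 := by omega
        subst this
        rw [List.replicate_eq_nil_iff] at h'
        unfold lastLetter at h1
        omega
    · intro j hj
      simp only [mu, List.mem_flatMap] at hj
      obtain ⟨i, -, hj⟩ := hj
      unfold muLetter at hj
      split_ifs at hj with hi'
      · simp only [List.mem_append, List.mem_replicate, List.mem_singleton] at hj
        omega
      · simp only [List.mem_replicate] at hj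
        omega

theorem word_succ (c : List ℕ) (hc : WH c) (n : ℕ) :
    ∃ x : List ℕ, x ≠ [] ∧ word c (n + 1) = word c n ++ x := by
  refine ⟨(mu c)^[n] (List.replicate (letter c 0 - 1) 0 ++ [1]), ?_, ?_⟩
  · refine mu_iter_ne_nil c hc n _ (by simp) fun i hi => ?_
    have := hc.1
    simp only [List.mem_append, List.mem_replicate, List.mem_singleton] at hi
    omega
  · rw [word, word, ← mu_iter_append, Function.iterate_succ_apply]
    congr 1
    have h2 : 0 + 1 < c.length := hc.1
    obtain ⟨t, ht⟩ : ∃ t, letter c 0 = t + 1 := ⟨letter c 0 - 1, by have := hc.2.1; omega⟩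
    simp [mu, muLetter, h2, ht, List.replicate_succ]

theorem word_prefix (c : List ℕ) (hc : WH c) {m n : ℕ} (h : m ≤ n) : word c m <+: word c n := by
  induction n, h using Nat.le_induction with
  | base => exact List.prefix_rfl
  | succ n _ ih =>
    obtain ⟨x, -, hx⟩ := word_succ c hc n
    exact ih.trans ⟨x, hx.symm⟩

theorem lt_U (c : List ℕ) (hc : WH c) (n : ℕ) : n < U c n := by
  induction n with
  | zero => simp [U, word]
  | succ n ih =>
    obtain ⟨x, hx, h⟩ := word_succ c hc n
    have := List.length_pos_iff.2 hx
    simp only [U] at ih ⊢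
    rw [h, List.length_append]
    omega

/-- Every `u_n` is a prefix of the infinite word `u`. -/
theorem word_eq_pre (c : List ℕ) (hc : WH c) (n : ℕ) : word c n = pre (u c) (U c n) := by
  apply List.ext_getElem
  · simp [pre, U]
  · intro i h1 h2
    have hi : i < (word c i).length := lt_U c hc i
    simp only [pre, List.getElem_map, List.getElem_range, u]
    rw [List.getD_eq_getElem _ _ hi]
    rcases le_total i n with h | h
    · exact ((word_prefix c hc h).getElem hi).symm
    · exact (word_prefix c hc h).getElem h1

/-- The lengths of the prefixes of `u` that are fractional powers of `u_n`. -/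
def fracPowLengths (c : List ℕ) (n : ℕ) : Set ℕ := {m | IsFracPow (pre (u c) m) (word c n)}

/-- `Q_n`, the length of the longest prefix of `u` that is a fractional power of `u_n`. -/
noncomputable def Q (c : List ℕ) (n : ℕ) : ℕ := sSup (fracPowLengths c n)

/-- `P_n`. -/
def P (c : List ℕ) (n : ℕ) : ℤ :=
  if n < c.length then (U c n : ℤ)
  else (U c n : ℤ) + (U c (n - c.length + 1) : ℤ) - (U c (n - c.length) : ℤ) - 1

/-! ### The associated numeration system -/

/-- The word `u_N ^ {l_0} u_{N-1} ^ {l_1} ⋯ u_0 ^ {l_N}` for `l = l_0 ⋯ l_N`. -/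
def wordVal (c : List ℕ) : List ℕ → List ℕ
  | [] => []
  | d :: s => wpow (word c s.length) d ++ wordVal c s

/-- `l = l_0 ⋯ l_N` is the representation of `n` in the numeration system `S_c`, that is, it comes
from the word-greedy factorization `u[0, n) = u_N ^ {l_0} ⋯ u_0 ^ {l_N}`: one has `l_0 ≥ 1`, the word
`u_{N+1}` is not a prefix of `u[0, n)`, and no exponent can be increased, in the sense that
`u_N ^ {l_0} ⋯ u_{N-i+1} ^ {l_{i-1}} u_{N-i} ^ {l_i + 1}` is never a prefix of `u[0, n)`.
For `n = 0` the only representation is the empty word. -/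
def IsRep (c : List ℕ) (n : ℕ) (l : List ℕ) : Prop :=
  l.head? ≠ some 0 ∧ pre (u c) n = wordVal c l ∧ ¬ word c l.length <+: pre (u c) n ∧
    ∀ (p : List ℕ) (d : ℕ) (s : List ℕ), l = p ++ d :: s →
      ¬ wordVal c (p ++ (d + 1) :: List.replicate s.length 0) <+: pre (u c) n

/-- The value `l_0 V_N + ⋯ + l_N V_0` of `l = l_0 ⋯ l_N` for a sequence `V` of integers. -/
def val (V : ℕ → ℕ) : List ℕ → ℕ
  | [] => 0
  | d :: s => d * V s.length + val V s

/-- `l = l_0 ⋯ l_N` is the greedy representation of `n` based on the sequence `V`, that is, the one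
given by the Euclidean algorithm: `n < V_{N+1}`, and what remains of `n` after the digits
`l_0, …, l_i` is less than `V_{N-i}`. -/
def IsGreedyRep (V : ℕ → ℕ) (n : ℕ) (l : List ℕ) : Prop :=
  l.head? ≠ some 0 ∧ val V l = n ∧ ∀ s : List ℕ, s <:+ l → val V s < V s.length

/-! ### The four conditions -/

/-- The word `c_0 ⋯ c_{k-2} (c_{k-1} - 1)`. -/
def decLast (c : List ℕ) : List ℕ := c.dropLast ++ [lastLetter c - 1]

/-- `u[0, U_{n+1} - 1)` is a fractional power of `u_n` for all `n`. -/
def FracPowCondition (c : List ℕ) : Prop :=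
  ∀ n : ℕ, IsFracPow (pre (u c) (U c (n + 1) - 1)) (word c n)

/-- `d[0, n] ≤ a[0, n]` for all `n`, where `d` and `a` are the infinite concatenations of
`c_0 ⋯ c_{k-2} (c_{k-1} - 1)` and of `w`. -/
def PrefixCondition (c w : List ℕ) : Prop :=
  ∀ n : ℕ, pre (omega (decLast c)) (n + 1) ≤ pre (omega w) (n + 1)

/-- The numeration system `S_c` is greedy: the representations in it are the greedy ones based on
the sequence `(U_n)`. -/
def GreedyCondition (c : List ℕ) : Prop :=
  ∀ (n : ℕ) (l : List ℕ), IsRep c n l ↔ IsGreedyRep (U c) n l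

end GenBonacci

/-!
Write `d = w ^ ω`. All four conditions are used only to show that `c_0 ⋯ c_{k-2}` is a prefix of `d`
(`letter_eq_omega`). Indeed, let `i` be the first place where it is not. If `c_i < d_i`, then
`c_0 ⋯ c_i` is a longer anti-Lyndon prefix, by Duval's argument (`IsAntiLyndon.pre_of_lt`). If
`c_i > d_i`, then the second condition fails at once, the third because rotating by `|w|` gives a larger
conjugate, and the fourth because `c_0 ⋯ c_i` is the representation of `U_{i+1} - 1` in `S_c` but is not
greedy; for the first condition see below.

The main point is that then `Q_n = d_0 U_n + d_1 U_{n-1} + ⋯ + d_n U_0` (`fracPowLengths_eq_Iic_val`).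
The longest common prefix `q_n` of `u` and of the infinite power of `u_n` is followed by two distinct
letters `a` and `b`, and applying `μ_c` gives `q_{n+1} = μ_c(q_n) 0 ^ e` with `e` the number of zeros
by which the images of the two sides agree. That `e = d_{n+1}` follows by keeping track of `a` and `b`
(`exists_follows`): the prefixes of `d` of lengths `a` and `b` are suffixes of `d_0 ⋯ d_n`, and one of
`a`, `b` is in phase with the period `|w|`, so that its image shows exactly `d_{n+1}` zeros before the
next letter, while the image of the other shows at least as many. The two letters stay distinct since
an anti-Lyndon word is unbordered: a shift of `d` out of phase becomes smaller than `d` before the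
current copy of `w` ends (`IsAntiLyndon.exists_lt`). The same description, run up to the first place
where `c` exceeds `d`, contradicts the first condition there (`not_isFracPow_of_omega_lt`).

With the recurrence `U_n = c_0 U_{n-1} + ⋯ + c_{k-1} U_{n-k}`, the inequality `P_{n+1} - 1 ≤ Q_n` for
`n = k - 1 + m` becomes `c_{k-1} U_m + U_{m+1} ≤ (d_{k-1} U_m + ⋯ + d_{k-1+m} U_0) + U_m + 2`. If `|w|`
divides `k - 1` the bracket is `Q_m`, and the inequality holds for all `m` when `c_{k-1} = 1` and fails
for `m = 1` otherwise. If `|w|` does not divide `k - 1`, it fails for `m = |w|`, by a lexicographic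
estimate on the bracket (`val_pre_omega_lt`). Covering follows, as `Q_n` is unbounded and `P_0 = 1`.
-/

namespace GenBonacci

/-! ### Powers and prefixes of words -/

theorem wpow_succ {A : Type*} (x : List A) (n : ℕ) : wpow x (n + 1) = x ++ wpow x n := by
  simp [wpow, List.replicate_succ]

theorem wpow_add {A : Type*} (x : List A) (m n : ℕ) :
    wpow x (m + n) = wpow x m ++ wpow x n := by
  rw [wpow, List.replicate_add, List.flatten_append]
  rfl

theorem length_wpow {A : Type*} (x : List A) (n : ℕ) : (wpow x n).length = n * x.length := by
  simp [wpow]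

theorem wpow_prefix_wpow {A : Type*} (x : List A) {m n : ℕ} (h : m ≤ n) :
    wpow x m <+: wpow x n := by
  obtain ⟨t, rfl⟩ := Nat.exists_eq_add_of_le h
  exact ⟨wpow x t, (wpow_add x m t).symm⟩

theorem isFracPow_iff_exists_prefix {A : Type*} {v z : List A} :
    IsFracPow v z ↔ ∃ n, v <+: wpow z n := by
  constructor
  · rintro ⟨l, x, ⟨t, rfl⟩, rfl⟩
    exact ⟨l + 1, t, by rw [wpow_add, List.append_assoc]; congr 1; simp [wpow]⟩
  · rintro ⟨n, hn⟩
    induction n generalizing v with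
    | zero => exact ⟨0, [], List.nil_prefix, by simpa [wpow] using hn⟩
    | succ n ih =>
      rw [wpow_succ] at hn
      rcases le_total v.length z.length with h | h
      · exact ⟨0, v, List.prefix_of_prefix_length_le hn (List.prefix_append _ _) h, by simp [wpow]⟩
      · obtain ⟨t, rfl⟩ := List.prefix_of_prefix_length_le (List.prefix_append _ _) hn h
        obtain ⟨l, x, hx, rfl⟩ := ih ((List.prefix_append_right_inj z).1 hn)
        exact ⟨l + 1, x, hx, by simp [wpow_succ]⟩

@[simp] theorem length_pre {A : Type*} (a : ℕ → A) (n : ℕ) : (pre a n).length = n := by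
  simp [pre]

@[simp] theorem getElem_pre {A : Type*} (a : ℕ → A) (n i : ℕ) (h : i < (pre a n).length) :
    (pre a n)[i] = a i := by
  simp [pre]

theorem pre_succ {A : Type*} (a : ℕ → A) (n : ℕ) : pre a (n + 1) = pre a n ++ [a n] := by
  simp [pre, List.range_succ]

theorem pre_add {A : Type*} (a : ℕ → A) (m n : ℕ) :
    pre a (m + n) = pre a m ++ pre (fun i => a (m + i)) n := by
  simp [pre, List.range_add, Function.comp_def]

theorem pre_congr {A : Type*} {a b : ℕ → A} {n : ℕ} (h : ∀ i < n, a i = b i) :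
    pre a n = pre b n := by
  simpa [pre] using h

theorem eq_pre_of_forall_getD {v : List ℕ} {a : ℕ → ℕ} {n : ℕ} (hn : v.length = n)
    (h : ∀ i < n, v.getD i 0 = a i) : v = pre a n := by
  apply List.ext_getElem (by simp [hn])
  intro i h1 h2
  rw [getElem_pre, ← h i (by omega), List.getD_eq_getElem _ _ h1]

theorem pre_prefix_pre {A : Type*} (a : ℕ → A) {m n : ℕ} (h : m ≤ n) : pre a m <+: pre a n := by
  obtain ⟨t, rfl⟩ := Nat.exists_eq_add_of_le h
  exact ⟨_, (pre_add a m t).symm⟩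

theorem lt_of_first_difference {v w : List ℕ} {i : ℕ} (hv : i < v.length) (hw : i < w.length)
    (h : ∀ (j : ℕ) (hj : j < i), v[j] = w[j]) (hi : v[i] < w[i]) : v < w :=
  List.lt_iff_exists.2 (Or.inr ⟨i, hv, hw, h, hi⟩)

/-! ### Anti-Lyndon words and their infinite powers -/

theorem omega_add_length (w : List ℕ) (n : ℕ) : omega w (n + w.length) = omega w n := by
  simp [omega]

theorem omega_mod (w : List ℕ) (n : ℕ) : omega w (n % w.length) = omega w n := by
  simp [omega]

theorem omega_congr (w : List ℕ) {m n : ℕ} (h : m ≡ n [MOD w.length]) :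
    omega w m = omega w n := by
  rw [← omega_mod w m, ← omega_mod w n, h]

theorem omega_add_of_mod_eq_zero (w : List ℕ) {s : ℕ} (h : s % w.length = 0) (i : ℕ) :
    omega w (s + i) = omega w i :=
  omega_congr w (by simp [Nat.ModEq, Nat.add_mod, h])

theorem omega_of_lt {w : List ℕ} {n : ℕ} (h : n < w.length) : omega w n = w[n] := by
  simp [omega, Nat.mod_eq_of_lt h, h]

theorem pre_omega_length (w : List ℕ) : pre (omega w) w.length = w := by
  apply List.ext_getElem (by simp)
  intro i h1 h2
  rw [getElem_pre, omega_of_lt h2]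

theorem pre_mul_of_periodic {a : ℕ → ℕ} {g : ℕ} (h : ∀ j, a (j + g) = a j) (t : ℕ) :
    pre a (g * t) = wpow (pre a g) t := by
  induction t with
  | zero => simp [pre, wpow]
  | succ t ih =>
    rw [Nat.mul_succ, Nat.add_comm, pre_add, wpow_succ, ← ih]
    congr 1
    exact pre_congr fun i _ => by rw [Nat.add_comm, h]

theorem periodic_gcd {a : ℕ → ℕ} (m n : ℕ) (hm : ∀ j, a (j + m) = a j)
    (hn : ∀ j, a (j + n) = a j) : ∀ j, a (j + m.gcd n) = a j := by
  induction m, n using Nat.gcd.induction with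
  | H0 n => simpa using hn
  | H1 m n _ ih =>
    rw [Nat.gcd_rec]
    refine ih (fun j => ?_) hm
    have hmul : ∀ t i, a (i + m * t) = a i := by
      intro t
      induction t with
      | zero => simp
      | succ t iht => intro i; rw [Nat.mul_succ, ← Nat.add_assoc, hm, iht]
    rw [← hmul (n / m), Nat.add_assoc, Nat.mod_add_div, hn]

/-- Maximality among the conjugates, read on the periodic word `w ^ ω`. -/
theorem IsMaxConj.omega_le {w : List ℕ} (hw : IsMaxConj w) {r j : ℕ} (hj : j < w.length)
    (h : ∀ i < j, omega w (r + i) = omega w i) : omega w (r + j) ≤ omega w j := by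
  by_contra! hlt
  have hrot : ∀ i (hi : i < (w.rotate r).length), (w.rotate r)[i] = omega w (r + i) := by
    intro i hi
    rw [List.getElem_rotate, ← omega_of_lt, omega_mod, Nat.add_comm]
  refine absurd (hw (w.rotate r) ⟨w.length - r % w.length, ?_⟩) (not_le.2 ?_)
  · rw [List.rotate_rotate, ← List.rotate_mod]
    have := Nat.mod_lt r (by omega : 0 < w.length)
    have h2 : (r + (w.length - r % w.length)) % w.length = 0 := by
      have h3 := Nat.mod_add_div r w.length
      have : r + (w.length - r % w.length) = w.length * (r / w.length + 1) := by
        rw [Nat.mul_succ]; omega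
      rw [this, Nat.mul_mod_right]
    rw [h2, List.rotate_zero]
  · refine lt_of_first_difference hj (by simpa using hj) (fun i hi => ?_) ?_
    · rw [hrot, h i hi, omega_of_lt]
    · rwa [hrot, ← omega_of_lt]

/-- A shift of `w ^ ω` by a non-multiple of `|w|` is smaller than `w ^ ω`, and the difference shows
before the end of the current copy of `w`: this combines primitivity (the shift differs from
`w ^ ω`) with the fact that an anti-Lyndon word has no proper border. -/
theorem IsAntiLyndon.exists_lt {w : List ℕ} (hw : IsAntiLyndon w) {s : ℕ}
    (hs : s % w.length ≠ 0) :
    ∃ j < w.length - s % w.length,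
      (∀ i < j, omega w (s + i) = omega w i) ∧ omega w (s + j) < omega w j := by
  set p := w.length with hp
  have hp0 : 0 < p := List.length_pos_iff.2 hw.1.1
  set r := s % p with hr
  have hrp : r < p := Nat.mod_lt _ hp0
  have hsr : ∀ i, omega w (s + i) = omega w (r + i) := fun i =>
    omega_congr w (by simp [Nat.ModEq, hr, ← hp])
  simp only [hsr]
  have hex : ∃ j, j < p - r ∧ omega w (r + j) ≠ omega w j := by
    by_contra! hall
    -- The suffix of length `p - r` is a border; maximality of the rotations by `r` and by `p - r`
    -- then gives the period `r`.
    have hper : ∀ i, i < r → omega w (p - r + i) = omega w i := by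
      intro i
      induction i using Nat.strong_induction_on with
      | _ i ih =>
        intro hi
        apply le_antisymm
        · exact hw.2.omega_le (by omega) fun j hj => ih j hj (by omega)
        · have h1 := hw.2.omega_le (r := r) (j := p - r + i) (by omega) fun j hj => by
            rcases lt_or_ge j (p - r) with h | h
            · exact hall j h
            · obtain ⟨j', rfl⟩ := Nat.exists_eq_add_of_le h
              rw [ih j' (by omega) (by omega), show r + (p - r + j') = j' + p by omega,
                omega_add_length]
          rwa [show r + (p - r + i) = i + p by omega, omega_add_length] at h1
    have hperiod : ∀ j, omega w (j + r) = omega w j := by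
      have hlt : ∀ j < p, omega w (j + r) = omega w j := by
        intro j hj
        rcases lt_or_ge j (p - r) with h | h
        · rw [Nat.add_comm, hall j h]
        · obtain ⟨j', rfl⟩ := Nat.exists_eq_add_of_le h
          rw [hper j' (by omega), show p - r + j' + r = j' + p by omega, omega_add_length]
      intro j
      rw [← omega_mod w j, ← hlt _ (Nat.mod_lt _ hp0)]
      exact omega_congr w (by simp [Nat.ModEq, hp])
    have hg := periodic_gcd r p hperiod (omega_add_length w)
    have hdvd : r.gcd p ∣ p := Nat.gcd_dvd_right r p
    have hpos : 0 < r.gcd p := Nat.gcd_pos_of_pos_right _ hp0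
    have hle : r.gcd p ≤ r := Nat.gcd_le_left _ (by omega)
    obtain ⟨t, ht⟩ := hdvd
    have h1 := hw.1.2 (pre (omega w) (r.gcd p)) t
      (by rw [← List.length_pos_iff, length_pre]; exact hpos)
      (by rw [← pre_mul_of_periodic hg, ← ht, pre_omega_length])
    rw [h1] at ht
    omega
  classical
  obtain ⟨h1, h2⟩ := Nat.find_spec hex
  have hmin : ∀ i < Nat.find hex, omega w (r + i) = omega w i := fun i hi => by
    by_contra hne
    exact Nat.find_min hex hi ⟨by omega, hne⟩
  exact ⟨Nat.find hex, h1, hmin, lt_of_le_of_ne (hw.2.omega_le (by omega) hmin) h2⟩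

theorem IsAntiLyndon.omega_le {w : List ℕ} (hw : IsAntiLyndon w) {s j : ℕ}
    (h : ∀ i < j, omega w (s + i) = omega w i) : omega w (s + j) ≤ omega w j := by
  by_cases hs : s % w.length = 0
  · exact (omega_add_of_mod_eq_zero w hs j).le
  · obtain ⟨j', -, h1, h2⟩ := hw.exists_lt hs
    rcases lt_trichotomy j j' with hj | rfl | hj
    · exact (h1 j hj).le
    · exact h2.le
    · exact absurd (h j' hj) h2.ne

/-- A finite word is anti-Lyndon as soon as each of its proper suffixes differs from the prefix of the
same length and is smaller at the first difference. -/
theorem isAntiLyndon_pre {a : ℕ → ℕ} {n : ℕ} (hn : 0 < n)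
    (h : ∀ r, 0 < r → r < n → ∃ j, r + j < n ∧ (∀ i < j, a (r + i) = a i) ∧ a (r + j) < a j) :
    IsAntiLyndon (pre a n) := by
  refine ⟨⟨by rw [← List.length_pos_iff, length_pre]; exact hn, fun x t hx hxt => ?_⟩,
    fun x hx => ?_⟩
  · by_contra ht
    have hlen := congrArg List.length hxt
    rw [length_pre, length_wpow] at hlen
    have hxpos := List.length_pos_iff.2 hx
    obtain ⟨t, rfl⟩ : ∃ m, t = m + 2 := by
      rcases t with _ | _ | t
      · omega
      · omega
      · exact ⟨t, rfl⟩
    obtain ⟨j, hj, -, hlt⟩ := h x.length hxpos (by nlinarith)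
    have hpre : wpow x (t + 1) <+: pre a n := hxt ▸ wpow_prefix_wpow x (by omega)
    have h1 : j < (wpow x (t + 1)).length := by rw [length_wpow]; nlinarith
    have h2 := hpre.getElem h1
    rw [getElem_pre] at h2
    have h3 : x.length + j < (pre a n).length := by simpa using hj
    have h4 : (pre a n)[x.length + j] = (wpow x (t + 1))[j] := by
      simp only [hxt, wpow_succ x (t + 1)]
      rw [List.getElem_append_right (by omega)]
      simp
    rw [getElem_pre] at h4
    omega
  · obtain ⟨r, hr, rfl⟩ := List.isRotated_iff_mod.1 hx.symm
    rw [length_pre] at hr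
    rcases Nat.eq_zero_or_pos r with rfl | hr0
    · simp
    rcases hr.eq_or_lt with rfl | hrn
    · have := List.rotate_length (pre a r)
      rw [length_pre] at this
      rw [this]
    obtain ⟨j, hj, heq, hlt⟩ := h r hr0 hrn
    have hrot : ∀ i (hi : i < ((pre a n).rotate r).length), r + i < n →
        ((pre a n).rotate r)[i] = a (r + i) := by
      intro i hi hin
      rw [List.getElem_rotate, getElem_pre, length_pre, Nat.add_comm, Nat.mod_eq_of_lt hin]
    refine le_of_lt (lt_of_first_difference (i := j) (by simp; omega) (by simp; omega)
      (fun i hi => ?_) ?_)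
    · rw [hrot _ _ (by omega), getElem_pre, heq i hi]
    · rw [hrot _ _ hj, getElem_pre]
      exact hlt

/-- The step of Duval's algorithm that creates a new anti-Lyndon prefix: a word that follows
`w ^ ω` and then drops below it is anti-Lyndon. -/
theorem IsAntiLyndon.pre_of_lt {w : List ℕ} (hw : IsAntiLyndon w) {a : ℕ → ℕ} {n : ℕ}
    (h : ∀ i < n, a i = omega w i) (hlt : a n < omega w n) :
    IsAntiLyndon (pre a (n + 1)) := by
  refine isAntiLyndon_pre (by omega) fun r hr0 hrn => ?_
  by_cases hr : r % w.length = 0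
  · have hsh := omega_add_of_mod_eq_zero w hr
    refine ⟨n - r, by omega, fun i hi => ?_, ?_⟩
    · rw [h _ (by omega), h _ (by omega), hsh]
    · rw [h (n - r) (by omega), ← hsh, show r + (n - r) = n by omega]
      exact hlt
  · obtain ⟨j, -, heq, hj⟩ := hw.exists_lt hr
    rcases lt_trichotomy (r + j) n with hc | hc | hc
    · refine ⟨j, by omega, fun i hi => ?_, ?_⟩
      · rw [h _ (by omega), h _ (by omega), heq i hi]
      · rw [h _ hc, h _ (by omega)]
        exact hj
    · refine ⟨j, by omega, fun i hi => ?_, ?_⟩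
      · rw [h _ (by omega), h _ (by omega), heq i hi]
      · rw [hc, h j (by omega)]
        rw [hc] at hj
        omega
    · refine ⟨n - r, by omega, fun i hi => ?_, ?_⟩
      · rw [h _ (by omega), h _ (by omega), heq i (by omega)]
      · have := heq (n - r) (by omega)
        rw [show r + (n - r) = n by omega] at this ⊢
        rw [h (n - r) (by omega), ← this]
        exact hlt

/-! ### The morphism on words and on lengths -/

theorem mu_append (c x y : List ℕ) : mu c (x ++ y) = mu c x ++ mu c y := by
  simp [mu]

theorem mu_singleton (c : List ℕ) (i : ℕ) : mu c [i] = muLetter c i := by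
  simp [mu]

theorem mu_prefix (c : List ℕ) {x y : List ℕ} (h : x <+: y) : mu c x <+: mu c y := by
  obtain ⟨t, rfl⟩ := h
  exact ⟨mu c t, (mu_append c x t).symm⟩

theorem mu_wpow (c x : List ℕ) (n : ℕ) : mu c (wpow x n) = wpow (mu c x) n := by
  induction n with
  | zero => simp [wpow, mu]
  | succ n ih => rw [wpow_succ, mu_append, ih, wpow_succ]

theorem mu_word (c : List ℕ) (n : ℕ) : mu c (word c n) = word c (n + 1) :=
  (Function.iterate_succ_apply' (mu c) n [0]).symm

theorem wpow_word_zero (c : List ℕ) (e : ℕ) : wpow (word c 0) e = List.replicate e 0 := by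
  simp [wpow, word]

theorem mu_wordVal_append (c l : List ℕ) (e : ℕ) :
    mu c (wordVal c l) ++ List.replicate e 0 = wordVal c (l ++ [e]) := by
  induction l with
  | nil => simp [wordVal, mu, wpow_word_zero]
  | cons x l ih =>
    rw [wordVal, mu_append, mu_wpow, mu_word, List.append_assoc, ih, List.cons_append, wordVal]
    simp

theorem length_wordVal (c l : List ℕ) : (wordVal c l).length = val (U c) l := by
  induction l with
  | nil => simp [wordVal, val]
  | cons x l ih => simp [wordVal, val, ih, length_wpow, U]

/-- For `n ≤ k - 1` the last letter of `u_n` is `n`, its first occurrence in `u`. -/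
theorem word_eq_wordVal_append (c : List ℕ) {n : ℕ} (hn : n < c.length) :
    word c n = wordVal c (pre (letter c) n) ++ [n] := by
  induction n with
  | zero => simp [word, pre, wordVal]
  | succ n ih =>
    rw [← mu_word, ih (by omega), mu_append, mu_singleton, muLetter, if_pos hn,
      ← List.append_assoc, mu_wordVal_append, pre_succ]

theorem U_eq_val (c : List ℕ) {n : ℕ} (hn : n < c.length) :
    U c n = val (U c) (pre (letter c) n) + 1 := by
  rw [U, word_eq_wordVal_append c hn, List.length_append, length_wordVal]
  simp

theorem U_zero (c : List ℕ) : U c 0 = 1 := by simp [U, word]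

theorem length_iterate_replicate (c : List ℕ) (n e : ℕ) :
    ((mu c)^[n] (List.replicate e 0)).length = e * U c n := by
  have h : ∀ m, (mu c)^[n] (wpow [0] m) = wpow (word c n) m := by
    intro m
    induction m with
    | zero =>
      have : (mu c)^[n] ([] : List ℕ) = [] := by
        induction n with
        | zero => rfl
        | succ n ih => rw [Function.iterate_succ_apply]; simpa [mu] using ih
      simpa [wpow] using this
    | succ m ih => rw [wpow_succ, mu_iter_append, ih, wpow_succ, word]
  have h0 : List.replicate e 0 = wpow [0] e := by simp [wpow]
  rw [h0, h, length_wpow, U]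

theorem U_eq_sum_add (c : List ℕ) {m n : ℕ} (hm : m < c.length) (hmn : m ≤ n) :
    U c n = ∑ j ∈ Finset.range m, letter c j * U c (n - 1 - j) +
      ((mu c)^[n - m] [m]).length := by
  induction m with
  | zero => simp [U, word]
  | succ m ih =>
    rw [ih (by omega) (by omega), Finset.sum_range_succ]
    obtain ⟨t, rfl⟩ := Nat.exists_eq_add_of_le hmn
    rw [show m + 1 + t - m = t + 1 by omega, show m + 1 + t - (m + 1) = t by omega,
      show m + 1 + t - 1 - m = t by omega, Function.iterate_succ_apply, mu_singleton, muLetter,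
      if_pos hm, mu_iter_append, List.length_append, length_iterate_replicate]
    ring

/-- The linear recurrence of order `k` satisfied by the lengths `U_n`. -/
theorem U_length_add (c : List ℕ) (hc : WH c) (m : ℕ) :
    U c (c.length + m) =
      ∑ j ∈ Finset.range (c.length - 1), letter c j * U c (c.length + m - 1 - j) +
        lastLetter c * U c m := by
  have := hc.1
  rw [U_eq_sum_add c (m := c.length - 1) (by omega) (by omega),
    show c.length + m - (c.length - 1) = m + 1 by omega, Function.iterate_succ_apply,
    mu_singleton, muLetter, if_neg (by omega), length_iterate_replicate, lastLetter]

theorem val_pre_succ (V a : ℕ → ℕ) (n : ℕ) :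
    val V (pre a (n + 1)) = a 0 * V n + val V (pre (fun i => a (1 + i)) n) := by
  rw [Nat.add_comm, pre_add]
  simp [pre, val]

theorem val_pre_add (V a : ℕ → ℕ) (m n : ℕ) :
    val V (pre a (m + n)) = ∑ j ∈ Finset.range m, a j * V (m + n - 1 - j) +
      val V (pre (fun i => a (m + i)) n) := by
  induction m generalizing a with
  | zero => simp
  | succ m ih =>
    rw [show m + 1 + n = (m + n) + 1 by omega, val_pre_succ, ih, Finset.sum_range_succ']
    have h1 : ∀ j, m + n + 1 - 1 - (j + 1) = m + n - 1 - j := by intro j; omega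
    have h2 : ∀ j, 1 + (m + j) = m + 1 + j := by intro j; omega
    simp only [h1, h2, Nat.add_comm 1]
    simp
    ring

/-- The lexicographic bound behind greediness: if `c_j` agrees with `w ^ ω` for `j < K`, then the
value of each factor of `w ^ ω` of length `m ≤ K` is less than `U_m`. -/
theorem val_pre_omega_lt {c w : List ℕ} (hw : IsAntiLyndon w) {K : ℕ} (hK : K < c.length)
    (hA : ∀ j < K, letter c j = omega w j) {m : ℕ} (hm : m ≤ K) (s : ℕ) :
    val (U c) (pre (fun i => omega w (s + i)) m) < U c m := by
  induction m using Nat.strong_induction_on generalizing s with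
  | _ m ih =>
    rw [U_eq_val c (by omega : m < c.length), pre_congr fun i hi => hA i (by omega)]
    by_cases hs : s % w.length = 0
    · rw [pre_congr fun i _ => omega_add_of_mod_eq_zero w hs i]
      omega
    obtain ⟨j, -, heq, hlt⟩ := hw.exists_lt hs
    rcases le_or_gt m j with hj | hj
    · rw [pre_congr fun i hi => heq i (by omega)]
      omega
    obtain ⟨t, rfl⟩ : ∃ t, m = j + (t + 1) := ⟨m - j - 1, by omega⟩
    rw [val_pre_add _ _ j (t + 1), val_pre_add _ _ j (t + 1), val_pre_succ, val_pre_succ,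
      Finset.sum_congr rfl fun i hi => by rw [heq i (Finset.mem_range.1 hi)]]
    have h1 := ih t (by omega) (by omega) (s + j + 1)
    simp only [Nat.add_assoc, Nat.add_zero] at h1 ⊢
    have h2 : (omega w (s + j) + 1) * U c t ≤ omega w j * U c t := Nat.mul_le_mul_right _ hlt
    rw [Nat.add_mul] at h2
    omega

/-! ### Where `u` leaves the infinite power of `u_n` -/

/-- The length-`a` prefix of `w ^ ω` is a suffix of its length-`(n + 1)` prefix, with `a ≤ K`. -/
def IsBorder (w : List ℕ) (K n a : ℕ) : Prop :=
  a ≤ K ∧ a ≤ n + 1 ∧ ∀ i < a, omega w (n + 1 - a + i) = omega w i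

/-- The letter that takes over from the letter `a` when the words compared at stage `n` are replaced
by their images. With `d = w ^ ω`, the factor `0 ^ {d_{n+1}}` of the image is followed by `a + 1` if
`d_{n+1} = c_a`, and otherwise by a further `0`. The letter `K` is reset to `0`, as is right for the
last letter `k - 1`. -/
def nextLetter (w : List ℕ) (K n a : ℕ) : ℕ :=
  if a < K ∧ omega w (n + 1) = omega w a then a + 1 else 0

/-- The border `a` is in phase with `w ^ ω` at stage `n` (the matching suffix starts at a multiple of
`|w|`), and either `b` is in phase too or `a` can grow by one at each stage up to the end of the
current copy of `w` without exceeding `K`. -/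
def InPhase (w : List ℕ) (K n a b : ℕ) : Prop :=
  a % w.length = (n + 1) % w.length ∧
    (b % w.length = (n + 1) % w.length ∨ a + (w.length - (n + 1) % w.length) ≤ K)

theorem IsBorder.nextLetter {w : List ℕ} {K n a : ℕ} (h : IsBorder w K n a) :
    IsBorder w K (n + 1) (nextLetter w K n a) := by
  obtain ⟨-, h2, h3⟩ := h
  unfold GenBonacci.nextLetter
  split_ifs with hif
  · refine ⟨hif.1, by omega, fun i hi => ?_⟩
    rw [show n + 1 + 1 - (a + 1) + i = n + 1 - a + i by omega]
    rcases Nat.lt_succ_iff_lt_or_eq.1 hi with hi | rfl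
    · exact h3 i hi
    · rw [show n + 1 - i + i = n + 1 by omega, hif.2]
  · exact ⟨Nat.zero_le _, Nat.zero_le _, fun i hi => absurd hi (Nat.not_lt_zero i)⟩

theorem IsBorder.omega_le {w : List ℕ} (hw : IsAntiLyndon w) {K n a : ℕ}
    (h : IsBorder w K n a) : omega w (n + 1) ≤ omega w a := by
  have := hw.omega_le h.2.2
  rwa [Nat.sub_add_cancel h.2.1] at this

/-- Borders out of phase are short and stop before the end of a copy of `w`. -/
theorem IsBorder.mod_ne_zero {w : List ℕ} (hw : IsAntiLyndon w) {K n a : ℕ}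
    (h : IsBorder w K n a) (ha : a % w.length ≠ (n + 1) % w.length) :
    (n + 1) % w.length ≠ 0 := by
  obtain ⟨-, h2, h3⟩ := h
  have hsum : n + 1 - a + a = n + 1 := Nat.sub_add_cancel h2
  have hs : (n + 1 - a) % w.length ≠ 0 := by
    intro h0
    apply ha
    rw [← hsum, Nat.add_mod, h0]
    simp
  obtain ⟨j, hj, -, hlt⟩ := hw.exists_lt hs
  have haj : a ≤ j := by
    by_contra! hja
    exact absurd (h3 j hja) hlt.ne
  have : (n + 1) % w.length = (n + 1 - a) % w.length + a := by
    conv_lhs => rw [← hsum]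
    rw [Nat.add_mod, Nat.mod_eq_of_lt (by omega : a < w.length), Nat.mod_eq_of_lt (by omega)]
  omega

theorem add_le_of_mod_eq {p a K : ℕ} (h : a < K) (hmod : a % p = K % p) : a + p ≤ K := by
  have hd : p ∣ K - a := (Nat.modEq_iff_dvd' h.le).1 hmod
  have := Nat.le_of_dvd (by omega) hd
  omega

theorem add_one_mod_of_ne_zero {p n : ℕ} (h : (n + 1) % p ≠ 0) : (n + 1) % p = n % p + 1 := by
  rcases Nat.eq_zero_or_pos p with rfl | hp
  · simp
  have hlt := Nat.mod_lt n hp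
  have h2 : (n + 1) % p = (n % p + 1) % p := by simp
  rcases Nat.lt_or_ge (n % p + 1) p with h1 | h1
  · rw [h2, Nat.mod_eq_of_lt h1]
  · rw [h2, show n % p + 1 = p by omega, Nat.mod_self] at h
    exact absurd rfl h

theorem InPhase.next_of_lt {w : List ℕ} (hw : IsAntiLyndon w) {K n a b : ℕ}
    (h : InPhase w K n a b) (haK : a < K) (hb : IsBorder w K n b) :
    nextLetter w K n a = a + 1 ∧ InPhase w K (n + 1) (nextLetter w K n a) (nextLetter w K n b) := by
  obtain ⟨h1, h2⟩ := h
  have hp : 0 < w.length := List.length_pos_iff.2 hw.1.1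
  have hna : nextLetter w K n a = a + 1 :=
    if_pos ⟨haK, omega_congr w h1.symm⟩
  rw [hna]
  refine ⟨rfl, ?_, ?_⟩
  · rw [Nat.add_mod, h1, ← Nat.add_mod]
  · by_cases hb' : nextLetter w K n b % w.length = (n + 1 + 1) % w.length
    · exact Or.inl hb'
    right
    have hmod := add_one_mod_of_ne_zero (hb.nextLetter.mod_ne_zero hw hb')
    have hlt := Nat.mod_lt (n + 1 + 1) hp
    have key : a + (w.length - (n + 1) % w.length) ≤ K := by
      rcases h2 with h2 | h2
      · have hbK : ¬ b < K := by
          intro hbK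
          apply hb'
          rw [nextLetter, if_pos ⟨hbK, omega_congr w h2.symm⟩, Nat.add_mod, h2, ← Nat.add_mod]
        have : b = K := le_antisymm hb.1 (not_lt.1 hbK)
        have := add_le_of_mod_eq (p := w.length) haK (by rw [← this, h1, h2])
        omega
      · exact h2
    omega

/-- Two distinct borders, one of them in phase, are never both reset to `0`, so they are continued
by distinct borders. -/
theorem InPhase.next {w : List ℕ} (hw : IsAntiLyndon w) {K n a b : ℕ} (hab : a ≠ b)
    (ha : IsBorder w K n a) (hb : IsBorder w K n b) (h : InPhase w K n a b) :
    nextLetter w K n a ≠ nextLetter w K n b ∧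
      (InPhase w K (n + 1) (nextLetter w K n a) (nextLetter w K n b) ∨
        InPhase w K (n + 1) (nextLetter w K n b) (nextLetter w K n a)) := by
  have hne : ∀ x y, x ≠ y → nextLetter w K n x = x + 1 →
      nextLetter w K n x ≠ nextLetter w K n y := by
    intro x y hxy hx
    rw [hx, nextLetter]
    split_ifs <;> omega
  rcases ha.1.lt_or_eq with haK | haK
  · obtain ⟨h1, h2⟩ := h.next_of_lt hw haK hb
    exact ⟨hne a b hab h1, Or.inl h2⟩
  · have hp : 0 < w.length := List.length_pos_iff.2 hw.1.1
    have hlt := Nat.mod_lt (n + 1) hp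
    have hbph : b % w.length = (n + 1) % w.length := by
      rcases h.2 with h2 | h2
      · exact h2
      · omega
    have hbK : b < K := by have := hb.1; omega
    obtain ⟨h1, h2⟩ := InPhase.next_of_lt hw (a := b) (b := a) ⟨hbph, Or.inl h.1⟩ hbK ha
    exact ⟨(hne b a hab.symm h1).symm, Or.inr h2⟩

/-- `X` starts with `q a y` for some letter `y` that is `0` or larger than `a`. This constraint on
the next letter is preserved by `μ_c`; it makes the letter `k - 1`, whose image contains no
nonzero letter, always followed by `0`. -/
def Follows (c X q : List ℕ) (a : ℕ) : Prop :=
  ∃ y, q ++ [a, y] <+: X ∧ (y = 0 ∨ a < y ∧ y < c.length)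

theorem replicate_zero_prefix (N δ b : ℕ) (h : δ < N) :
    ∃ y, List.replicate δ 0 ++ [0, y] <+: List.replicate N 0 ++ [b] ∧ (y = 0 ∨ y = b) := by
  obtain ⟨t, rfl⟩ := Nat.exists_eq_add_of_lt h
  rw [show δ + t + 1 = δ + (t + 1) by omega, List.replicate_add, List.append_assoc]
  rcases t with _ | t
  · exact ⟨b, by simp, Or.inr rfl⟩
  · refine ⟨0, ?_, Or.inl rfl⟩
    rw [List.prefix_append_right_inj]
    simp [List.replicate_succ]

/-- One application of `μ_c` to a word with a known letter at a known position. -/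
theorem Follows.mu {c X q : List ℕ} {a δ : ℕ} (hc : WH c) (h : Follows c X q a)
    (ha : a < c.length) (hδ : a + 1 < c.length → δ ≤ letter c a)
    (hδ' : a + 1 = c.length → δ ≤ letter c 0) :
    Follows c (mu c X) (mu c q ++ List.replicate δ 0)
      (if a + 1 < c.length ∧ δ = letter c a then a + 1 else 0) := by
  obtain ⟨hk, hc0, hcl⟩ := hc
  obtain ⟨y, hX, hy⟩ := h
  have hX' := mu_prefix c hX
  rw [show q ++ [a, y] = q ++ ([a] ++ [y]) from rfl, mu_append, mu_append, mu_singleton,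
    mu_singleton] at hX'
  suffices hs : ∃ y', List.replicate δ 0 ++
      [if a + 1 < c.length ∧ δ = letter c a then a + 1 else 0, y'] <+:
        muLetter c a ++ muLetter c y ∧
      (y' = 0 ∨ (if a + 1 < c.length ∧ δ = letter c a then a + 1 else 0) < y' ∧
        y' < c.length) by
    obtain ⟨y', h1, h2⟩ := hs
    refine ⟨y', ?_, h2⟩
    rw [List.append_assoc]
    exact (((List.prefix_append_right_inj _).2 h1)).trans hX'
  by_cases ha1 : a + 1 < c.length
  · rcases (hδ ha1).lt_or_eq with hlt | heq
    · rw [if_neg (by omega), muLetter, if_pos ha1]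
      obtain ⟨y', h1, h2⟩ := replicate_zero_prefix (letter c a) δ (a + 1) hlt
      exact ⟨y', h1.trans (List.prefix_append _ _), by omega⟩
    · rw [if_pos ⟨ha1, heq⟩, heq, muLetter, if_pos ha1]
      have hfirst : ∃ y' t, muLetter c y = y' :: t ∧ (y' = 0 ∨ a + 1 < y' ∧ y' < c.length) := by
        unfold muLetter
        by_cases hcy : letter c y = 0
        · have hy0 : y ≠ 0 := by rintro rfl; omega
          have hyk : y + 1 < c.length := by
            by_contra hyk
            have : y = c.length - 1 := by omega
            rw [lastLetter, ← this] at hcl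
            omega
          rw [if_pos hyk, hcy]
          exact ⟨y + 1, [], rfl, by omega⟩
        · obtain ⟨t, ht⟩ := Nat.exists_eq_succ_of_ne_zero hcy
          rw [ht]
          split_ifs
          · exact ⟨0, _, rfl, Or.inl rfl⟩
          · exact ⟨0, _, rfl, Or.inl rfl⟩
      obtain ⟨y', t, h1, h2⟩ := hfirst
      exact ⟨y', ⟨t, by simp [h1]⟩, h2⟩
  · -- Here `a = k - 1` is followed by `0`, whose image adds enough zeros.
    have hak : a + 1 = c.length := by omega
    have hy0 : y = 0 := by omega
    subst hy0
    rw [if_neg (by omega), muLetter, if_neg ha1, muLetter, if_pos (by omega), ← List.append_assoc,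
      ← List.replicate_add]
    have hla : lastLetter c = letter c a := by rw [lastLetter, ← hak]; simp
    have := hδ' hak
    obtain ⟨y', h1, h2⟩ := replicate_zero_prefix (letter c a + letter c 0) δ (0 + 1) (by omega)
    exact ⟨y', h1, by omega⟩

/-- For all `n`, or for `n < K` when `K < k - 1`: the word `u_n^{d_0} ⋯ u_0^{d_n}`, with
`d = w ^ ω`, is a prefix of both `u` and the infinite power of `u_n`, and is followed in them by
distinct borders `a` and `b`. -/
theorem exists_follows {c w : List ℕ} (hc : WH c) (hw : IsAntiLyndon w) {K : ℕ}
    (hpK : w.length ≤ K) (hK : K < c.length) (hA : ∀ j < K, letter c j = omega w j) (n : ℕ)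
    (hn : K + 1 = c.length ∨ n + 1 ≤ K) :
    ∃ a b, a ≠ b ∧ IsBorder w K n a ∧ IsBorder w K n b ∧
      (InPhase w K n a b ∨ InPhase w K n b a) ∧ (n + 1 ≤ K → a = n + 1) ∧
      (∃ N, Follows c (word c N) (wordVal c (pre (omega w) (n + 1))) a) ∧
      ∃ M, Follows c (wpow (word c n) M) (wordVal c (pre (omega w) (n + 1))) b := by
  have hp : 0 < w.length := List.length_pos_iff.2 hw.1.1
  induction n with
  | zero =>
    have hq : wordVal c (pre (omega w) (0 + 1)) = List.replicate (omega w 0) 0 := by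
      simp [pre, wordVal, wpow_word_zero]
    have h0 : letter c 0 = omega w 0 := hA 0 (by omega)
    refine ⟨1, 0, by omega, ⟨by omega, by omega, ?_⟩, ⟨by omega, by omega, by omega⟩,
      Or.inl ⟨by simp, ?_⟩, by omega, ⟨2, ?_⟩, ⟨omega w 0 + 2, 0, ?_, Or.inl rfl⟩⟩
    · intro i hi
      simp
    · rcases Nat.lt_or_ge 1 w.length with h | h
      · right
        rw [Nat.mod_eq_of_lt (by omega)]
        omega
      · left
        rw [show w.length = 1 by omega]
    · have h1 : Follows c (word c 1) [] 0 := by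
        obtain ⟨t, ht⟩ : ∃ t, letter c 0 = t + 1 := ⟨letter c 0 - 1, by have := hc.2.1; omega⟩
        have hw1 : word c 1 = List.replicate (t + 1) 0 ++ [1] := by
          have := hc.1
          rw [word, Function.iterate_one, mu_singleton, muLetter, if_pos (by omega), ht]
        obtain ⟨y, hy1, hy2⟩ := replicate_zero_prefix (t + 1) 0 1 (by omega)
        have := hc.1
        exact ⟨y, by rw [hw1]; simpa using hy1, by omega⟩
      have hk := hc.1
      have h2 := h1.mu hc (δ := omega w 0) (by omega) (fun _ => h0.ge) (fun _ => h0.ge)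
      rw [if_pos ⟨by omega, h0.symm⟩, mu_word] at h2
      rw [hq]
      simpa [GenBonacci.mu] using h2
    · rw [hq, wpow_word_zero, List.replicate_add]
      exact List.prefix_rfl
  | succ n ih =>
    obtain ⟨a, b, hab, ha, hb, hph, hfst, ⟨N, hN⟩, ⟨M, hM⟩⟩ := ih (by omega)
    have hstep : ∀ X x, (x < K ∨ K + 1 = c.length) → IsBorder w K n x →
        Follows c X (wordVal c (pre (omega w) (n + 1))) x →
        Follows c (mu c X) (wordVal c (pre (omega w) (n + 1 + 1))) (nextLetter w K n x) := by
      intro X x hxK hx hX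
      have hxK' := hx.1
      have h1 := hX.mu hc (δ := omega w (n + 1)) (by omega)
        (fun h => by rw [hA x (by omega)]; exact hx.omega_le hw)
        (fun _ => by rw [hA 0 (by omega)]; exact hw.omega_le (s := n + 1) (j := 0) (by simp))
      rw [mu_wordVal_append, ← pre_succ] at h1
      convert h1 using 1
      unfold nextLetter
      rcases Nat.lt_or_ge x K with h | h
      · rw [hA x h]
        simp only [h, true_and, show x + 1 < c.length by omega]
      · rw [if_neg (by omega), if_neg (by omega)]
    have haK : a < K ∨ K + 1 = c.length := by omega
    have hbK : b < K ∨ K + 1 = c.length := by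
      have := hb.2.1
      omega
    have hnext : nextLetter w K n a ≠ nextLetter w K n b ∧
        (InPhase w K (n + 1) (nextLetter w K n a) (nextLetter w K n b) ∨
          InPhase w K (n + 1) (nextLetter w K n b) (nextLetter w K n a)) := by
      rcases hph with h | h
      · exact h.next hw hab ha hb
      · obtain ⟨h1, h2⟩ := h.next hw hab.symm hb ha
        exact ⟨h1.symm, h2.symm⟩
    refine ⟨_, _, hnext.1, ha.nextLetter, hb.nextLetter, hnext.2, fun hle => ?_,
      ⟨N + 1, ?_⟩, ⟨M, ?_⟩⟩
    · rw [hfst (by omega), nextLetter, if_pos ⟨by omega, rfl⟩]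
    · rw [← mu_word]
      exact hstep _ a haK ha hN
    · rw [← mu_word, ← mu_wpow]
      exact hstep _ b hbK hb hM

/-- If `u` and the infinite power of `u_n` have different letters after their common prefix `q`,
then the prefixes of `u` that are fractional powers of `u_n` are those of length at most `|q|`. -/
theorem fracPowLengths_eq {c q : List ℕ} (hc : WH c) {n N M a b : ℕ} (hab : a ≠ b)
    (ha : Follows c (word c N) q a) (hb : Follows c (wpow (word c n) M) q b) :
    fracPowLengths c n = Set.Iic q.length := by
  obtain ⟨y, hy, -⟩ := ha
  obtain ⟨z, hz, -⟩ := hb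
  have hu : q ++ [a] <+: word c N := List.IsPrefix.trans ⟨[y], by simp⟩ hy
  have hv : q ++ [b] <+: wpow (word c n) M := List.IsPrefix.trans ⟨[z], by simp⟩ hz
  have hqu : ∀ m ≥ q.length + 1, q ++ [a] <+: pre (u c) m := by
    intro m hm
    rw [word_eq_pre c hc] at hu
    have h1 : pre (u c) m <+: pre (u c) (max m (U c N)) := pre_prefix_pre _ (le_max_left _ _)
    have h2 : pre (u c) (U c N) <+: pre (u c) (max m (U c N)) :=
      pre_prefix_pre _ (le_max_right _ _)
    exact List.prefix_of_prefix_length_le (hu.trans h2) h1 (by simpa using hm)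
  ext m
  simp only [fracPowLengths, Set.mem_ofPred_eq, Set.mem_Iic, isFracPow_iff_exists_prefix]
  constructor
  · rintro ⟨t, ht⟩
    by_contra! hm
    have h1 := ((hqu m hm).trans ht).trans (wpow_prefix_wpow (word c n) (le_max_left t M))
    have h2 := hv.trans (wpow_prefix_wpow (word c n) (le_max_right t M))
    have h3 := List.prefix_of_prefix_length_le h1 h2 (by simp)
    rw [List.prefix_append_right_inj] at h3
    simp [hab] at h3
  · intro hm
    have h1 : pre (u c) m <+: q := by
      refine List.prefix_of_prefix_length_le (pre_prefix_pre (u c) (by omega : m ≤ q.length + 1))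
        (List.IsPrefix.trans (List.prefix_append q [a]) (hqu _ le_rfl)) (by simpa using hm)
    exact ⟨M, h1.trans (List.IsPrefix.trans (List.prefix_append q [b]) hv)⟩

theorem fracPowLengths_eq_Iic_val {c w : List ℕ} (hc : WH c) (hw : IsAntiLyndon w)
    (hwc : w.length < c.length) (hA : ∀ j < c.length - 1, letter c j = omega w j) (n : ℕ) :
    fracPowLengths c n = Set.Iic (val (U c) (pre (omega w) (n + 1))) := by
  obtain ⟨a, b, hab, -, -, -, -, ⟨N, hN⟩, ⟨M, hM⟩⟩ :=
    exists_follows hc hw (K := c.length - 1) (by omega) (by omega) hA n (by omega)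
  rw [fracPowLengths_eq hc hab hN hM, length_wordVal]

/-! ### Each of the four conditions makes `c_0 ⋯ c_{k-2}` a prefix of `w ^ ω` -/

theorem dropLast_eq_pre (c : List ℕ) : c.dropLast = pre (letter c) (c.length - 1) := by
  refine eq_pre_of_forall_getD (by simp) fun i hi => ?_
  have h1 : i < c.dropLast.length := by simpa using hi
  rw [List.getD_eq_getElem _ _ h1, letter, List.getD_eq_getElem _ _ (by omega),
    List.getElem_dropLast]

theorem omega_decLast {c : List ℕ} {j : ℕ} (hj : j < c.length - 1) :
    omega (decLast c) j = letter c j := by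
  have hlen : (decLast c).length = c.length := by simp [decLast]; omega
  have h1 : j < c.dropLast.length := by simpa using hj
  rw [omega_of_lt (by omega)]
  simp only [decLast]
  rw [List.getElem_append_left h1]
  simp only [dropLast_eq_pre, getElem_pre]

theorem le_of_mem_word (c : List ℕ) (n : ℕ) : ∀ x ∈ word c n, x ≤ n := by
  induction n with
  | zero => simp [word]
  | succ n ih =>
    intro x hx
    rw [← mu_word, mu, List.mem_flatMap] at hx
    obtain ⟨i, hi, hx⟩ := hx
    have := ih i hi
    unfold muLetter at hx
    split_ifs at hx
    · simp only [List.mem_append, List.mem_replicate, List.mem_singleton] at hx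
      omega
    · simp only [List.mem_replicate] at hx
      omega

theorem lt_of_mem_wordVal (c l : List ℕ) : ∀ x ∈ wordVal c l, x < l.length := by
  induction l with
  | nil => simp [wordVal]
  | cons e l ih =>
    intro x hx
    rw [wordVal, List.mem_append] at hx
    rw [List.length_cons]
    rcases hx with hx | hx
    · rw [wpow, List.mem_flatten] at hx
      obtain ⟨y, hy, hx⟩ := hx
      rw [List.eq_of_mem_replicate hy] at hx
      have := le_of_mem_word c _ x hx
      omega
    · have := ih x hx
      omega

theorem wordVal_append_prefix_iff (c q : List ℕ) {s t : List ℕ} (h : s.length = t.length) :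
    wordVal c (q ++ s) <+: wordVal c (q ++ t) ↔ wordVal c s <+: wordVal c t := by
  induction q with
  | nil => rfl
  | cons e q ih =>
    rw [List.cons_append, List.cons_append, wordVal, wordVal, List.length_append, h,
      ← List.length_append, List.prefix_append_right_inj, ih]

/-- For `i ≤ k - 2`, the word `c_0 ⋯ c_i` is the representation of `U_{i+1} - 1` in the numeration
system `S_c`: the letter `m` occurs in `u_m` but not in the shorter words `u_j`. -/
theorem isRep_pre_letter {c : List ℕ} (hc : WH c) {i : ℕ} (hi : i + 1 < c.length) :
    IsRep c (U c (i + 1) - 1) (pre (letter c) (i + 1)) := by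
  have hU := U_eq_val c hi
  have hpre : pre (u c) (U c (i + 1) - 1) = wordVal c (pre (letter c) (i + 1)) := by
    have h1 := word_eq_wordVal_append c hi
    rw [word_eq_pre c hc, show U c (i + 1) = U c (i + 1) - 1 + 1 by omega, pre_succ] at h1
    exact (List.append_inj' h1 rfl).1
  refine ⟨?_, hpre, ?_, ?_⟩
  · have := hc.2.1
    simp only [pre, List.range_succ_eq_map, List.map_cons, List.head?_cons, ne_eq,
      Option.some.injEq]
    omega
  · intro h
    have := h.length_le
    rw [length_pre, length_pre] at this
    rw [← U] at this
    omega
  · intro q e s hl h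
    have hlen := congrArg List.length hl
    simp only [length_pre, List.length_append, List.length_cons] at hlen
    rw [hpre, hl, wordVal_append_prefix_iff c q (by simp), wordVal, wordVal, wpow_add,
      List.append_assoc, List.length_replicate, List.prefix_append_right_inj] at h
    have h1 : s.length ∈ wpow (word c s.length) 1 := by
      rw [word_eq_wordVal_append c (by omega)]
      simp [wpow]
    have h2 := lt_of_mem_wordVal c s _ (h.subset (List.mem_append_left _ h1))
    omega

/-- If `i ≤ k - 2` is the first place where `c` differs from `w ^ ω` and `c_i` is larger there, then
`u[0, U_{i+1} - 1)` is not a fractional power of `u_i`. -/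
theorem not_isFracPow_of_omega_lt {c w : List ℕ} (hc : WH c) (hw : IsAntiLyndon w) {i : ℕ}
    (hwi : w.length ≤ i) (hi : i + 1 < c.length) (heq : ∀ j < i, letter c j = omega w j)
    (hlt : omega w i < letter c i) :
    ¬ IsFracPow (pre (u c) (U c (i + 1) - 1)) (word c i) := by
  have hp : 0 < w.length := List.length_pos_iff.2 hw.1.1
  obtain ⟨n, rfl⟩ : ∃ n, i = n + 1 := ⟨i - 1, by omega⟩
  obtain ⟨a, b, hab, -, hb, hph, hfst, ⟨N, hN⟩, ⟨M, hM⟩⟩ :=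
    exists_follows hc hw hwi (by omega) heq n (Or.inr le_rfl)
  obtain rfl := hfst le_rfl
  have hbi : b < n + 1 := by have := hb.2.1; omega
  have hbmod : b % w.length = (n + 1) % w.length := by
    have := Nat.mod_lt (n + 1) hp
    rcases hph with h | h
    · rcases h.2 with h | h
      · exact h
      · omega
    · exact h.1
  have hcb : letter c b = omega w (n + 1) := by rw [heq b hbi, omega_congr w hbmod]
  have h1 := hN.mu hc (δ := letter c b) (by omega) (fun _ => by omega) (fun _ => by omega)
  have h2 := hM.mu hc (δ := letter c b) (by omega) (fun _ => le_rfl) (fun _ => by omega)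
  rw [if_neg (by omega), mu_word] at h1
  rw [if_pos ⟨by omega, rfl⟩, mu_wpow, mu_word] at h2
  have h3 := fracPowLengths_eq hc (by omega) h1 h2
  intro h
  have h4 : U c (n + 1 + 1) - 1 ∈ fracPowLengths c (n + 1) := h
  have h5 : U c (n + 1 + 1) - 1 =
      (mu c (wordVal c (pre (omega w) (n + 1))) ++
        List.replicate (letter c (n + 1)) 0).length := by
    rw [U_eq_val c hi, mu_wordVal_append, length_wordVal, pre_succ, pre_congr heq]
    simp
  rw [h3, Set.mem_Iic, h5] at h4
  simp only [List.length_append, List.length_replicate] at h4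
  omega

/-- At the first place `i` where `c_0 ⋯ c_{k-2}` leaves `w ^ ω`, a smaller `c_i` contradicts the choice
of `w` as the longest anti-Lyndon prefix, and a larger one contradicts each of the conditions. -/
theorem letter_eq_omega {c w : List ℕ} (hc : WH c) (hw : IsLongestAntiLyndonPrefix w c.dropLast)
    (h : FracPowCondition c ∨ PrefixCondition c w ∨ IsMaxConj (decLast c) ∨ GreedyCondition c) :
    ∀ j < c.length - 1, letter c j = omega w j := by
  obtain ⟨hwpre, hwl, hmax⟩ := hw
  rw [dropLast_eq_pre] at hwpre hmax
  by_contra! hex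
  classical
  obtain ⟨hi, hne⟩ := Nat.find_spec hex
  have heq : ∀ j < Nat.find hex, letter c j = omega w j := fun j hj => by
    by_contra hj'
    exact Nat.find_min hex hj ⟨by omega, hj'⟩
  generalize Nat.find hex = i at hi hne heq
  have hwi : w.length ≤ i := by
    by_contra! hwi
    have := hwpre.getElem hwi
    rw [getElem_pre] at this
    rw [omega_of_lt hwi] at hne
    exact hne this.symm
  rcases hne.lt_or_gt with hlt | hlt
  · have := hmax _ (pre_prefix_pre (letter c) (by omega)) (hwl.pre_of_lt heq hlt)
    rw [length_pre] at this
    omega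
  obtain ⟨t, rfl⟩ := Nat.exists_eq_add_of_le hwi
  have hshift : ∀ j, omega w (w.length + j) = omega w j := fun j => by
    rw [Nat.add_comm, omega_add_length]
  have hp : 0 < w.length := List.length_pos_iff.2 hwl.1.1
  have hsucc : ∀ j < t, letter c (w.length + j) = letter c j := fun j hj => by
    rw [heq _ (by omega), heq _ (by omega), hshift]
  have hgt : letter c t < letter c (w.length + t) := by
    rwa [heq t (by omega), ← hshift]
  rcases h with h | h | h | h
  · exact not_isFracPow_of_omega_lt hc hwl hwi (by omega) heq hlt (h _)
  · refine absurd (h (w.length + t)) (not_le.2 (lt_of_first_difference (i := w.length + t)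
      (by simp) (by simp) (fun j hj => ?_) ?_))
    · rw [getElem_pre, getElem_pre, omega_decLast (by omega), heq j hj]
    · rwa [getElem_pre, getElem_pre, omega_decLast (by omega)]
  · have := h.omega_le (r := w.length) (j := t) (by simp [decLast]; omega) fun j hj => by
      rw [omega_decLast (by omega), omega_decLast (by omega), hsucc j hj]
    rw [omega_decLast (by omega), omega_decLast (by omega)] at this
    omega
  · have h1 := ((h _ _).1 (isRep_pre_letter hc (by omega : w.length + t + 1 < c.length))).2.2
      (pre (fun j => letter c (w.length + j)) (t + 1))
      ⟨pre (letter c) w.length, by rw [Nat.add_assoc, ← pre_add]⟩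
    rw [length_pre, U_eq_val c (by omega), val_pre_add _ _ t 1, val_pre_add _ (letter c) t 1,
      Finset.sum_congr rfl fun j hj => by rw [hsucc j (Finset.mem_range.1 hj)]] at h1
    simp only [val_pre_succ, U_zero, Nat.add_zero, Nat.mul_one] at h1
    simp only [pre, List.range_zero, List.map_nil, val] at h1
    omega

/-! ### Comparing `P_{n+1} - 1` with `Q_n` -/

theorem val_pre_two (V a : ℕ → ℕ) : val V (pre a 2) = a 0 * V 1 + a 1 * V 0 := by
  simp [pre, val, List.range_succ_eq_map]

/-- For `n ≥ k - 1` the common terms of the recurrence for `U_{n+1}` and of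
`Q_n = d_0 U_n + ⋯ + d_n U_0`, with `d = w ^ ω`, cancel. -/
theorem P_sub_one_le_iff {c w : List ℕ} (hc : WH c)
    (hA : ∀ j < c.length - 1, letter c j = omega w j) (m : ℕ) :
    P c (c.length - 1 + m + 1) - 1 ≤ (val (U c) (pre (omega w) (c.length - 1 + m + 1)) : ℤ) ↔
      lastLetter c * U c m + U c (m + 1) ≤
        val (U c) (pre (fun j => omega w (c.length - 1 + j)) (m + 1)) + U c m + 2 := by
  have hk := hc.1
  have h1 := U_length_add c hc m
  have h2 := val_pre_add (U c) (omega w) (c.length - 1) (m + 1)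
  have hn : c.length - 1 + m + 1 = c.length + m := by omega
  rw [show c.length - 1 + (m + 1) = c.length + m by omega,
    Finset.sum_congr rfl fun j hj => by rw [← hA j (Finset.mem_range.1 hj)]] at h2
  rw [hn, P, if_neg (by omega), Nat.add_sub_cancel_left, h1, h2]
  push_cast
  constructor
  · intro h
    zify
    linarith
  · intro h
    zify at h
    linarith

/-- If `c_0 ⋯ c_{k-2}` stops inside a copy of `w`, the tail of `w ^ ω` from there drops below `w ^ ω`
early enough for the inequality to fail at `n = k - 1 + |w|`. -/
theorem not_P_sub_one_le_of_mod_ne_zero {c w : List ℕ} (hc : WH c) (hw : IsAntiLyndon w)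
    (hwc : w.length < c.length) (hA : ∀ j < c.length - 1, letter c j = omega w j)
    (hr : (c.length - 1) % w.length ≠ 0) :
    ¬ P c (c.length - 1 + w.length + 1) - 1 ≤
      (val (U c) (pre (omega w) (c.length - 1 + w.length + 1)) : ℤ) := by
  have hp : 0 < w.length := List.length_pos_iff.2 hw.1.1
  rw [P_sub_one_le_iff hc hA]
  obtain ⟨hk, hc0, hcl⟩ := hc
  have hpk : w.length < c.length - 1 := by
    refine lt_of_le_of_ne (by omega) fun h => hr ?_
    rw [← h, Nat.mod_self]
  obtain ⟨j, hj, heq, hlt⟩ := hw.exists_lt hr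
  obtain ⟨t, ht⟩ : ∃ t, w.length = j + (t + 1) := ⟨w.length - j - 1, by omega⟩
  have hd : 1 ≤ omega w w.length := by
    rw [← Nat.zero_add w.length, omega_add_length, ← hA 0 (by omega)]
    exact hc0
  rw [U_eq_val c (by omega : w.length + 1 < c.length), pre_congr fun i hi => hA i (by omega),
    show w.length + 1 = j + (t + 1 + 1) by omega, val_pre_add _ _ j (t + 1 + 1),
    val_pre_add _ _ j (t + 1 + 1), val_pre_succ _ _ (t + 1), val_pre_succ _ _ (t + 1),
    val_pre_add _ (fun i => omega w (j + (1 + i))) t 1,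
    Finset.sum_congr rfl fun i hi => by rw [← heq i (Finset.mem_range.1 hi)]]
  have h1 := val_pre_omega_lt hw (K := c.length - 1) (by omega) hA (m := t + 1) (by omega)
    (c.length - 1 + j + 1)
  have h2 : (omega w (c.length - 1 + j) + 1) * U c (t + 1) ≤ omega w j * U c (t + 1) :=
    Nat.mul_le_mul_right _ hlt
  have h3 : U c w.length ≤ lastLetter c * U c w.length := Nat.le_mul_of_pos_left _ hcl
  have h4 : val (U c) (pre (fun i => omega w (j + (1 + (t + i)))) 1) = omega w w.length := by
    rw [val_pre_succ, U_zero, ht, show j + (1 + (t + 0)) = j + (t + 1) by omega]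
    simp [pre, val]
  simp only [Nat.add_assoc, Nat.add_zero] at h1 h2 h4 ⊢
  rw [Nat.add_mul] at h2
  omega

theorem not_P_sub_one_le_of_two_le {c w : List ℕ} (hc : WH c) (hw : IsAntiLyndon w)
    (hwc : w.length < c.length) (hA : ∀ j < c.length - 1, letter c j = omega w j)
    (hr : (c.length - 1) % w.length = 0) (hl : 2 ≤ lastLetter c) :
    ¬ P c (c.length - 1 + 1 + 1) - 1 ≤
      (val (U c) (pre (omega w) (c.length - 1 + 1 + 1)) : ℤ) := by
  have hp : 0 < w.length := List.length_pos_iff.2 hw.1.1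
  rw [P_sub_one_le_iff hc hA]
  simp only [omega_add_of_mod_eq_zero w hr]
  have hk := hc.1
  have h1 : U c 1 = letter c 0 + 1 := by
    rw [U_eq_val c (by omega)]
    simp [pre, val, U_zero]
  have h0 := hA 0 (by omega)
  have hmul : 2 * U c 1 ≤ lastLetter c * U c 1 := Nat.mul_le_mul_right _ hl
  have hc0 := hc.2.1
  rw [val_pre_two, U_zero]
  rcases Nat.lt_or_ge 2 c.length with hk2 | hk2
  · rw [U_eq_val c hk2, val_pre_two, U_zero, ← h0, ← hA 1 (by omega)]
    omega
  · have hk2 : c.length = 2 := by omega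
    have h2 := U_length_add c hc 0
    rw [hk2] at h2
    simp only [Nat.add_zero, Nat.reduceSub, Finset.sum_range_one, U_zero, Nat.mul_one,
      Nat.sub_zero] at h2
    have h3 : omega w 1 = omega w 0 := omega_congr w (by
      rw [show w.length = 1 by omega]; exact Nat.modEq_one)
    rw [h2, h3, ← h0]
    omega

theorem P_sub_one_le {c w : List ℕ} (hc : WH c)
    (hA : ∀ j < c.length - 1, letter c j = omega w j) (hr : (c.length - 1) % w.length = 0)
    (hl : lastLetter c = 1) (n : ℕ) :
    P c (n + 1) - 1 ≤ (val (U c) (pre (omega w) (n + 1)) : ℤ) := by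
  have hk := hc.1
  have hc0 := hc.2.1
  have hsmall : ∀ n, n + 1 < c.length → U c (n + 1) = val (U c) (pre (omega w) (n + 1)) + 1 := by
    intro n hn
    rw [U_eq_val c hn, pre_congr fun i hi => hA i (by omega)]
  rcases Nat.lt_or_ge (n + 1) c.length with hn | hn
  · rw [P, if_pos hn, hsmall n hn]
    simp
  obtain ⟨m, rfl⟩ : ∃ m, n = c.length - 1 + m := ⟨n - (c.length - 1), by omega⟩
  rw [P_sub_one_le_iff hc hA]
  rw [funext (omega_add_of_mod_eq_zero w hr), hl]
  suffices hs : U c (m + 1) ≤ val (U c) (pre (omega w) (m + 1)) + 1 by omega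
  rcases Nat.lt_or_ge (m + 1) c.length with hm | hm
  · exact (hsmall m hm).le
  obtain ⟨t, ht⟩ : ∃ t, m + 1 = c.length + t := ⟨m + 1 - c.length, by omega⟩
  have h2 := val_pre_add (U c) (omega w) (c.length - 1) (t + 1)
  rw [show c.length - 1 + (t + 1) = c.length + t by omega,
    Finset.sum_congr rfl fun j hj => by rw [← hA j (Finset.mem_range.1 hj)], val_pre_succ] at h2
  rw [ht, U_length_add c hc t, h2, hl]
  have h3 : U c t ≤ omega w (c.length - 1 + 0) * U c t := by
    refine Nat.le_mul_of_pos_left _ ?_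
    rw [omega_add_of_mod_eq_zero w hr, ← hA 0 (by omega)]
    omega
  omega

end GenBonacci

theorem propositionP (c w : List ℕ) (hc : GenBonacci.WH c)
    (hw : GenBonacci.IsLongestAntiLyndonPrefix w c.dropLast)
    (h : GenBonacci.FracPowCondition c ∨ GenBonacci.PrefixCondition c w ∨
      GenBonacci.IsMaxConj (GenBonacci.decLast c) ∨ GenBonacci.GreedyCondition c) :
    (∀ n : ℕ, IsGreatest (GenBonacci.fracPowLengths c n) (GenBonacci.Q c n)) ∧
    ((∀ n : ℕ, GenBonacci.P c (n + 1) - 1 ≤ (GenBonacci.Q c n : ℤ)) ↔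
      (GenBonacci.lastLetter c = 1 ∧ ∃ l : ℕ, c.dropLast = GenBonacci.wpow w l)) ∧
    ((∀ n : ℕ, GenBonacci.P c (n + 1) - 1 ≤ (GenBonacci.Q c n : ℤ)) →
      ∀ m : ℕ, 1 ≤ m → ∃ n : ℕ, GenBonacci.P c n ≤ (m : ℤ) ∧ m ≤ GenBonacci.Q c n) := by
  open GenBonacci in
  have hA := letter_eq_omega hc hw h
  obtain ⟨hwpre, hwl, -⟩ := hw
  obtain ⟨hk, hc0, hcl⟩ := id hc
  have hwc : w.length < c.length := by
    have := hwpre.length_le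
    rw [List.length_dropLast] at this
    omega
  have hF := fracPowLengths_eq_Iic_val hc hwl hwc hA
  have hQ : ∀ n, Q c n = val (U c) (pre (omega w) (n + 1)) := fun n => by
    rw [Q, hF, csSup_Iic]
  refine ⟨fun n => by rw [hF, hQ]; exact isGreatest_Iic, ⟨fun hP => ?_, ?_⟩, fun hP m hm => ?_⟩
  · simp only [hQ] at hP
    have hr : (c.length - 1) % w.length = 0 := by
      by_contra hr
      exact not_P_sub_one_le_of_mod_ne_zero hc hwl hwc hA hr (hP _)
    refine ⟨?_, (c.length - 1) / w.length, ?_⟩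
    · by_contra hl
      exact not_P_sub_one_le_of_two_le hc hwl hwc hA hr (by omega) (hP _)
    · have h1 := pre_mul_of_periodic (omega_add_length w) ((c.length - 1) / w.length)
      rwa [Nat.mul_div_cancel' (Nat.dvd_of_mod_eq_zero hr), pre_omega_length,
        ← pre_congr hA, ← dropLast_eq_pre] at h1
  · rintro ⟨hl, l, hwl'⟩ n
    have hr : (c.length - 1) % w.length = 0 := by
      have := congrArg List.length hwl'
      rw [List.length_dropLast, length_wpow] at this
      rw [this, Nat.mul_mod_left]
    rw [hQ]
    exact P_sub_one_le hc hA hr hl n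
  · classical
    -- The least `n` with `m ≤ Q_n` works: the interval before it ends below `m`.
    have hex : ∃ n, m ≤ Q c n := by
      refine ⟨m, ?_⟩
      have h1 := lt_U c hc m
      have h2 : U c m ≤ omega w 0 * U c m := by
        refine Nat.le_mul_of_pos_left _ ?_
        rw [← hA 0 (by omega)]
        omega
      rw [hQ, val_pre_succ]
      omega
    refine ⟨Nat.find hex, ?_, Nat.find_spec hex⟩
    rcases hn : Nat.find hex with _ | n
    · rw [P, if_pos (by omega), U_zero]
      exact_mod_cast hm
    · have h1 := Nat.find_min hex (m := n) (by omega)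
      have h2 := hP n
      omega
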